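/- Let $D$ be a simple directed graph (no loops, no multiple edges) on a finite vertex set. The simple random walk on $D$ has transition matrix $P$ with $P(u,v)=1/d^+(u)$ if $u\to v$ is an edge, where $d^+(u)$ is the out-degree of $u$, and $P(u,v)=0$ otherwise. If $D$ is strongly connected, there is exactly one probability distribution $\phi$ on the vertices with $\phi P=\phi$ (the stationary distribution), and all its entries are positive; the principal ratio of $D$ is $\gamma(D)=\max_u\phi(u)/\min_u\phi(u)$. For every $n\ge 3$, the maximum of $\gamma(D)$ over all strongly connected simple directed graphs $D$ on $n$ vertices is exactly \[ \gamma(n)=\frac{2}{3}\left(\frac{n}{n-1}+\frac{1}{(n-1)!}\sum_{i=1}^{n-3} i!\right)(n-1)!. \] Moreover, a simple directed graph on $n$ vertices is strongly connected with principal ratio $\gamma(n)$ if and only if it is isomorphic to one of the following three directed graphs $D_1,D_2,D_3$, which are pairwise non-isomorphic. Each $D_k$ has vertex set $\{v_1,\dots,v_n\}$ and edge set \[ \{(v_i,v_{i+1}) : 1\le i\le n-1\}\cup\{(v_j,v_i): 1\le i<j\le n-1\}\cup S(D_k), \] where $S(D_1)=\{(v_n,v_1)\}$, $S(D_2)=\{(v_n,v_2)\}$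 and $S(D_3)=\{(v_n,v_1),(v_n,v_2)\}$. -/

import Mathlib

open Finset
open scoped Nat Matrix

namespace Digraph

/-- A digraph is simple if it has no loops. (Multiple edges are impossible, as the edges form a
relation on the vertices.) -/
def IsSimple {V : Type*} (D : Digraph V) : Prop :=
  ∀ v, ¬ D.Adj v v

/-- A digraph is strongly connected if every vertex can be reached from every vertex along a
directed walk. -/
def IsStronglyConnected {V : Type*} (D : Digraph V) : Prop :=
  ∀ u v, Relation.ReflTransGen D.Adj u v

/-- Two digraphs are isomorphic if some bijection of their vertex sets preserves and reflects
the edges. -/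
def IsIsomorphic {V W : Type*} (D : Digraph V) (E : Digraph W) : Prop :=
  Nonempty (D.Adj ≃r E.Adj)

/-- The out-degree of a vertex. -/
noncomputable def outDegree {V : Type*} (D : Digraph V) (u : V) : ℕ :=
  {v | D.Adj u v}.ncard

open Classical in
/-- The transition probability matrix of the simple random walk on a digraph. -/
noncomputable def transitionMatrix {V : Type*} (D : Digraph V) : Matrix V V ℝ :=
  fun u v => if D.Adj u v then 1 / (D.outDegree u : ℝ) else 0

/-- A probability distribution `p` on the vertices with `p P = p`, where `P` is the transition
probability matrix of the simple random walk and `p` is viewed as a row vector. -/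
structure IsStationaryDistribution {V : Type*} [Fintype V] (D : Digraph V) (p : V → ℝ) : Prop where
  nonneg : ∀ v, 0 ≤ p v
  sum_eq_one : ∑ v, p v = 1
  stationary : p ᵥ* D.transitionMatrix = p

open Classical in
/-- The stationary distribution of the simple random walk on a strongly connected digraph
(a junk value if there is no stationary distribution). -/
noncomputable def perronVector {V : Type*} [Fintype V] (D : Digraph V) : V → ℝ :=
  if h : ∃ p, D.IsStationaryDistribution p then h.choose else 0

/-- The principal ratio: the largest entry of the stationary distribution divided by its smallest
entry. -/
noncomputable def principalRatio {V : Type*} [Fintype V] (D : Digraph V) : ℝ :=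
  (⨆ v, D.perronVector v) / (⨅ v, D.perronVector v)

/-- With `v₁, …, vₙ` written as `0, …, n - 1`: the digraph consisting of the path
`v₁ → v₂ → ⋯ → vₙ`, of all edges `vⱼ → vᵢ` with `1 ≤ i < j ≤ n - 1`, and of the edges from `vₙ` to
the vertices whose (zero-based) index lies in `S`. -/
def pathWithBackEdges (n : ℕ) (S : Set ℕ) : Digraph (Fin n) where
  Adj a b :=
    (a : ℕ) + 1 = (b : ℕ) ∨
    ((b : ℕ) < (a : ℕ) ∧ (a : ℕ) + 1 < n) ∨
    ((a : ℕ) + 1 = n ∧ (b : ℕ) ∈ S)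

/-- The last vertex has the single out-neighbour `v₁`. -/
def extremal₁ (n : ℕ) : Digraph (Fin n) := pathWithBackEdges n {0}

/-- The last vertex has the single out-neighbour `v₂`. -/
def extremal₂ (n : ℕ) : Digraph (Fin n) := pathWithBackEdges n {1}

/-- The last vertex has the two out-neighbours `v₁` and `v₂`. -/
def extremal₃ (n : ℕ) : Digraph (Fin n) := pathWithBackEdges n {0, 1}

end Digraph

/-!
Existence and uniqueness of the stationary distribution `p` follow from the triangle inequality: if
`q` is a left null vector of `P - 1`, then so is `|q|`, and a nonnegative invariant vector of a
strongly connected digraph is zero or positive.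

For the bound on `p u / p v`, let `n` be the number of vertices, let `δ a` be the distance from `a`
to `v`, and write `f a = p a / d⁺(a)` for the flow along each edge leaving `a`. Compare the flow out
of the set `A = {a | j + 1 ≤ δ a}` with the flow into it. Each vertex at level `j + 1` has an edge
to level `j`, so the outflow is at least the sum `Lⱼ₊₁` of `f` over that level. The inflow is at
most `p v + |A| Qⱼ`, where `Qⱼ` is the sum of `f` over the levels `1, …, j`. The levels below
`j + 1` are nonempty, so `|A| ≤ n - (j + 1)`, and therefore
`Lⱼ₊₁ ≤ p v + (n - (j + 1)) Qⱼ` (`IsLevelFunction.levelFlow_succ_le`).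
Hence `Qⱼ ≤ Tⱼ · p v`, where `T₀ = 0` and `Tⱼ₊₁ = 1 + (n - j) Tⱼ` (`flowBound`). A vertex `u` at
level `k + 1` has out-degree at most `n - (k + 1)`, so that
`p u ≤ (n - (k + 1)) (1 + (n - (k + 1)) Tₖ) · p v` (`ratioBound`). This bound is strictly increasing
in `k` up to `k = n - 3`, where its value is `2/3 * ∑_{i=1}^{n-1} i!`, and it is not larger for
`k = n - 2`.

If the bound is attained, then it is attained by a vertex at level `n - 2`, since a vertex at level
`n - 1` has a single out-neighbour, which is at least as probable. Then all the estimates above are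
equalities (`IsLevelFunction.adj_of_le_levelFlow_succ`): all levels are singletons, all edges to
higher levels are present from the levels `1, …, n - 2`, and the out-neighbours of `v` lie in the
two highest levels. These are the three extremal digraphs (`IsExtremalLabelling`), and for them all
the estimates are indeed equalities. The three are told apart by the vertices with exactly one
out-neighbour.
-/

namespace Digraph

section

open scoped Classical

variable {V : Type*} {D : Digraph V} {p : V → ℝ} {a b u v : V}

/-! ### The stationary distribution of a strongly connected digraph -/

lemma exists_adj_of_isStronglyConnected [Nontrivial V] (hD : D.IsStronglyConnected) (a : V) :
    ∃ b, D.Adj a b := by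
  obtain ⟨b, hb⟩ := exists_ne a
  rcases (hD a b).cases_head with h | ⟨c, hc, -⟩
  · exact absurd h.symm hb
  · exact ⟨c, hc⟩

lemma transitionMatrix_nonneg (D : Digraph V) (a b : V) : 0 ≤ D.transitionMatrix a b := by
  unfold transitionMatrix
  split_ifs <;> positivity

variable [Fintype V]

lemma outDegree_eq_card (D : Digraph V) (a : V) : D.outDegree a = #{b | D.Adj a b} := by
  rw [outDegree, Set.ncard_eq_toFinset_card']
  congr 1
  ext b
  simp

lemma outDegree_pos (h : ∃ b, D.Adj a b) : 0 < D.outDegree a := by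
  obtain ⟨b, hb⟩ := h
  rw [outDegree_eq_card, card_pos]
  exact ⟨b, by simpa using hb⟩

lemma transitionMatrix_pos (h : D.Adj a b) : 0 < D.transitionMatrix a b := by
  have := outDegree_pos ⟨b, h⟩
  simp only [transitionMatrix, h, if_true]
  positivity

lemma sum_transitionMatrix_row (h : ∃ b, D.Adj a b) : ∑ b, D.transitionMatrix a b = 1 := by
  have := outDegree_pos h
  simp only [transitionMatrix]
  rw [← sum_filter, sum_const, ← outDegree_eq_card, nsmul_eq_mul]
  field_simp

lemma sum_mul_transitionMatrix (hp : p ᵥ* D.transitionMatrix = p) (b : V) :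
    ∑ a, p a * D.transitionMatrix a b = p b :=
  congrFun hp b

/-- By the triangle inequality `|q| ≤ |q| P`, and both sides have the same sum. -/
lemma abs_vecMul_transitionMatrix (h : ∀ a, ∃ b, D.Adj a b) {q : V → ℝ}
    (hq : q ᵥ* D.transitionMatrix = q) : |q| ᵥ* D.transitionMatrix = |q| := by
  have hle : ∀ b ∈ (univ : Finset V), |q b| ≤ ∑ a, |q a| * D.transitionMatrix a b := by
    intro b _
    calc |q b| = |∑ a, q a * D.transitionMatrix a b| := by rw [sum_mul_transitionMatrix hq]
      _ ≤ ∑ a, |q a * D.transitionMatrix a b| := abs_sum_le_sum_abs _ _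
      _ = _ := by simp only [abs_mul, abs_of_nonneg (transitionMatrix_nonneg D _ _)]
  have hsum : ∑ b, |q b| = ∑ b, ∑ a, |q a| * D.transitionMatrix a b := by
    rw [sum_comm]
    exact sum_congr rfl fun a _ => by rw [← mul_sum, sum_transitionMatrix_row (h a), mul_one]
  funext b
  exact ((sum_eq_sum_iff_of_le hle).1 hsum b (mem_univ b)).symm

lemma pos_of_vecMul_transitionMatrix (hD : D.IsStronglyConnected) (h0 : ∀ a, 0 ≤ p a)
    (hp : p ᵥ* D.transitionMatrix = p) (hu : 0 < p u) (v : V) : 0 < p v := by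
  induction hD u v with
  | refl => exact hu
  | @tail b c _ hbc ih =>
    rw [← sum_mul_transitionMatrix hp c]
    exact sum_pos' (fun a _ => mul_nonneg (h0 a) (transitionMatrix_nonneg D a c))
      ⟨b, mem_univ b, mul_pos ih (transitionMatrix_pos hbc)⟩

lemma IsStationaryDistribution.pos (hD : D.IsStronglyConnected)
    (hp : D.IsStationaryDistribution p) (v : V) : 0 < p v := by
  obtain ⟨u, -, hu⟩ : ∃ u ∈ univ, 0 < p u := by
    refine exists_lt_of_sum_lt (s := univ) (f := fun _ => (0 : ℝ)) ?_
    simp [hp.sum_eq_one]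
  exact pos_of_vecMul_transitionMatrix hD hp.nonneg hp.stationary hu v

/-- The rows of `P - 1` sum to zero, so `P - 1` is singular and has a left null vector `q`;
normalize `|q|`. -/
lemma exists_isStationaryDistribution [Nonempty V] (h : ∀ a, ∃ b, D.Adj a b) :
    ∃ p, D.IsStationaryDistribution p := by
  have hdet : (D.transitionMatrix - 1).det = 0 := by
    refine Matrix.exists_mulVec_eq_zero_iff.1 ⟨1, one_ne_zero, ?_⟩
    rw [Matrix.sub_mulVec, Matrix.one_mulVec, sub_eq_zero]
    funext a
    simpa [Matrix.mulVec, dotProduct] using sum_transitionMatrix_row (h a)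
  obtain ⟨q, hq0, hq⟩ := Matrix.exists_vecMul_eq_zero_iff.2 hdet
  rw [Matrix.vecMul_sub, Matrix.vecMul_one, sub_eq_zero] at hq
  have habs := abs_vecMul_transitionMatrix h hq
  obtain ⟨u, hu⟩ := Function.ne_iff.1 hq0
  have hpos : 0 < ∑ a, |q| a :=
    sum_pos' (fun a _ => abs_nonneg (q a)) ⟨u, mem_univ u, abs_pos.2 hu⟩
  refine ⟨(∑ a, |q| a)⁻¹ • |q|, fun a => ?_, ?_, ?_⟩
  · exact mul_nonneg (inv_nonneg.2 hpos.le) (abs_nonneg (q a))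
  · simp only [Pi.smul_apply, smul_eq_mul, ← mul_sum]
    exact inv_mul_cancel₀ hpos.ne'
  · rw [Matrix.smul_vecMul, habs]

/-- The vectors `|p - p'| + (p - p')` and `p - p'` are invariant; the former is nonnegative, so it
vanishes or is positive everywhere, and the entries of `p - p'` sum to zero. -/
lemma IsStationaryDistribution.eq (h : ∀ a, ∃ b, D.Adj a b) (hD : D.IsStronglyConnected)
    {p' : V → ℝ} (hp : D.IsStationaryDistribution p) (hp' : D.IsStationaryDistribution p') :
    p = p' := by
  set q := p - p' with hq
  have hqs : q ᵥ* D.transitionMatrix = q := by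
    rw [hq, Matrix.sub_vecMul, hp.stationary, hp'.stationary]
  have hsum : ∑ a, q a = 0 := by simp [hq, hp.sum_eq_one, hp'.sum_eq_one]
  have hadd : (|q| + q) ᵥ* D.transitionMatrix = |q| + q := by
    rw [Matrix.add_vecMul, hqs, abs_vecMul_transitionMatrix h hqs]
  have hnonneg : ∀ a, 0 ≤ (|q| + q) a := fun a => by
    have := neg_abs_le (q a)
    simp only [Pi.add_apply, Pi.abs_apply]
    linarith
  have hqle : ∀ a ∈ univ, q a ≤ 0 := by
    intro a _
    by_contra! ha
    have hall := pos_of_vecMul_transitionMatrix (u := a) hD hnonneg hadd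
      (by simpa using add_pos_of_nonneg_of_pos (abs_nonneg _) ha)
    have hqpos : ∀ b, 0 < q b := fun b => by
      by_contra! hb
      have := hall b
      simp [abs_of_nonpos hb] at this
    exact (sum_pos (fun b _ => hqpos b) ⟨a, mem_univ a⟩).ne' hsum
  have hq0 := (sum_eq_zero_iff_of_nonpos hqle).1 hsum
  funext a
  exact sub_eq_zero.1 (hq0 a (mem_univ a))

lemma isStationaryDistribution_perronVector [Nonempty V] (h : ∀ a, ∃ b, D.Adj a b) :
    D.IsStationaryDistribution D.perronVector := by
  have hex := exists_isStationaryDistribution h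
  rw [perronVector, dif_pos hex]
  exact hex.choose_spec

end

section

open scoped Classical

variable {V : Type*} {D : Digraph V} {p : V → ℝ} {δ : V → ℕ} {a b u v : V} {j k : ℕ}

/-! ### Probability flow across a cut -/

/-- The probability `p a / d⁺(a)` that flows along each edge leaving `a`, when the walk is
distributed according to `p`. -/
noncomputable def edgeFlow (D : Digraph V) (p : V → ℝ) (a : V) : ℝ :=
  p a / D.outDegree a

lemma edgeFlow_nonneg (hp : ∀ a, 0 < p a) (a : V) : 0 ≤ D.edgeFlow p a :=
  div_nonneg (hp a).le (Nat.cast_nonneg _)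

lemma edgeFlow_pos [Fintype V] (h : ∃ b, D.Adj a b) (hp : ∀ a, 0 < p a) :
    0 < D.edgeFlow p a :=
  div_pos (hp a) (Nat.cast_pos.2 (outDegree_pos h))

lemma edgeFlow_mul_outDegree [Fintype V] (h : ∃ b, D.Adj a b) :
    D.edgeFlow p a * D.outDegree a = p a := by
  have := outDegree_pos h
  rw [edgeFlow]
  field_simp

lemma sum_mul_transitionMatrix_eq_edgeFlow_mul (D : Digraph V) (p : V → ℝ) (a : V)
    (B : Finset V) :
    ∑ b ∈ B, p a * D.transitionMatrix a b = D.edgeFlow p a * #{b ∈ B | D.Adj a b} := by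
  simp only [transitionMatrix, edgeFlow, mul_ite, mul_zero]
  rw [← sum_filter, sum_const, nsmul_eq_mul]
  ring

/-- In equilibrium, the flow out of a set of vertices equals the flow into it. -/
lemma flow_out_eq_flow_in [Fintype V] (h : ∀ a, ∃ b, D.Adj a b)
    (hp : p ᵥ* D.transitionMatrix = p) (A : Finset V) :
    ∑ a ∈ A, D.edgeFlow p a * #{b ∈ Aᶜ | D.Adj a b} =
      ∑ a ∈ Aᶜ, D.edgeFlow p a * #{b ∈ A | D.Adj a b} := by
  simp only [← sum_mul_transitionMatrix_eq_edgeFlow_mul]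
  have hout : ∑ a ∈ A, p a = ∑ a ∈ A, ∑ b ∈ A, p a * D.transitionMatrix a b +
      ∑ a ∈ A, ∑ b ∈ Aᶜ, p a * D.transitionMatrix a b := by
    rw [← sum_add_distrib]
    refine sum_congr rfl fun a _ => ?_
    rw [sum_add_sum_compl, ← mul_sum, sum_transitionMatrix_row (h a), mul_one]
  have hin : ∑ b ∈ A, p b = ∑ b ∈ A, ∑ a ∈ A, p a * D.transitionMatrix a b +
      ∑ b ∈ A, ∑ a ∈ Aᶜ, p a * D.transitionMatrix a b := by
    rw [← sum_add_distrib]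
    refine sum_congr rfl fun b _ => ?_
    rw [sum_add_sum_compl, sum_mul_transitionMatrix hp]
  rw [sum_comm (s := A) (t := A)] at hin
  rw [sum_comm (s := Aᶜ) (t := A)]
  linarith

/-! ### Distance levels -/

/-- `δ a` is the length of a shortest directed walk from `a` to `v`, expressed by the local
properties that determine it. -/
structure IsLevelFunction (D : Digraph V) (v : V) (δ : V → ℕ) : Prop where
  eq_zero_iff : ∀ a, δ a = 0 ↔ a = v
  le_succ : ∀ a b, D.Adj a b → δ a ≤ δ b + 1
  exists_adj : ∀ a, a ≠ v → ∃ b, D.Adj a b ∧ δ b + 1 = δ a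

/-- There is a directed walk of length `m` from the given vertex to `v`. -/
def HasWalk (D : Digraph V) (v : V) : ℕ → V → Prop
  | 0, a => a = v
  | m + 1, a => ∃ b, D.Adj a b ∧ D.HasWalk v m b

lemma exists_isLevelFunction (hD : D.IsStronglyConnected) (v : V) :
    ∃ δ, D.IsLevelFunction v δ := by
  have hex : ∀ a, ∃ m, D.HasWalk v m a := by
    intro a
    induction hD a v using Relation.ReflTransGen.head_induction_on with
    | refl => exact ⟨0, rfl⟩
    | @head b c hbc _ ih =>
      obtain ⟨m, hm⟩ := ih
      exact ⟨m + 1, c, hbc, hm⟩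
  refine ⟨fun a => Nat.find (hex a), fun a => ?_, fun a b hab => ?_, fun a ha => ?_⟩
  · rw [Nat.find_eq_zero]
    rfl
  · exact Nat.find_min' _ ⟨b, hab, Nat.find_spec (hex b)⟩
  · have h0 : Nat.find (hex a) ≠ 0 := by
      rw [Ne, Nat.find_eq_zero]
      exact ha
    obtain ⟨m, hm⟩ := Nat.exists_eq_succ_of_ne_zero h0
    have hspec := Nat.find_spec (hex a)
    rw [hm] at hspec
    obtain ⟨b, hab, hb⟩ := hspec
    refine ⟨b, hab, le_antisymm ?_ (Nat.find_min' _ ⟨b, hab, Nat.find_spec (hex b)⟩)⟩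
    have := Nat.find_min' (hex b) hb
    lia

lemma IsLevelFunction.apply_self (hδ : D.IsLevelFunction v δ) : δ v = 0 :=
  (hδ.eq_zero_iff v).2 rfl

lemma IsLevelFunction.exists_apply_eq (hδ : D.IsLevelFunction v δ) (hj : j ≤ δ a) :
    ∃ b, δ b = j := by
  induction hk : δ a generalizing a with
  | zero => exact ⟨a, by lia⟩
  | succ m ih =>
    by_cases hjm : j = m + 1
    · exact ⟨a, by lia⟩
    · have hav : a ≠ v := fun h => by
        have := (hδ.eq_zero_iff a).2 h
        lia
      obtain ⟨b, -, hb⟩ := hδ.exists_adj a hav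
      exact ih (a := b) (by lia) (by lia)

/-- The vertices at level `j` or higher. -/
def upperLevels [Fintype V] (δ : V → ℕ) (j : ℕ) : Finset V :=
  {a | j ≤ δ a}

@[simp]
lemma mem_upperLevels [Fintype V] : a ∈ upperLevels δ j ↔ j ≤ δ a := by
  simp [upperLevels]

/-- Each of the levels `0, …, j - 1` contains a vertex. -/
lemma IsLevelFunction.card_upperLevels_add_le [Fintype V] (hδ : D.IsLevelFunction v δ)
    (hj : j ≤ δ a + 1) : #(upperLevels δ j) + j ≤ Fintype.card V := by
  have hsub : range j ⊆ (upperLevels δ j)ᶜ.image δ := by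
    intro i hi
    rw [mem_range] at hi
    obtain ⟨b, hb⟩ := hδ.exists_apply_eq (a := a) (j := i) (by lia)
    exact mem_image.2 ⟨b, by simp [hb, hi], hb⟩
  have h1 := (card_le_card hsub).trans card_image_le
  rw [card_range] at h1
  rw [← card_add_card_compl (upperLevels δ j)]
  lia

/-- A vertex at level `j + 1` has no edge to the levels below `j`, nor to itself. -/
lemma IsLevelFunction.outDegree_add_le [Fintype V] (hδ : D.IsLevelFunction v δ)
    (hs : D.IsSimple) (ha : δ a = j + 1) : D.outDegree a + (j + 1) ≤ Fintype.card V := by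
  have h1 := hδ.card_upperLevels_add_le (a := a) (j := j) (by lia)
  have hmem : a ∈ upperLevels δ j := by simp [ha]
  have hsub : ({b | D.Adj a b} : Finset V) ⊆ (upperLevels δ j).erase a := by
    intro b hb
    simp only [mem_filter, mem_univ, true_and] at hb
    have := hδ.le_succ a b hb
    refine mem_erase.2 ⟨?_, by simp; lia⟩
    rintro rfl
    exact hs _ hb
  have h2 := card_le_card hsub
  rw [card_erase_of_mem hmem, ← outDegree_eq_card] at h2
  have := card_pos.2 ⟨a, hmem⟩
  lia

/-- The total edge flow at level `j`. -/
noncomputable def levelFlow [Fintype V] (D : Digraph V) (p : V → ℝ) (δ : V → ℕ) (j : ℕ) : ℝ :=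
  ∑ a with δ a = j, D.edgeFlow p a

/-- The total edge flow at the levels `1, …, j`. -/
noncomputable def lowerFlow [Fintype V] (D : Digraph V) (p : V → ℝ) (δ : V → ℕ) (j : ℕ) : ℝ :=
  ∑ a with 1 ≤ δ a ∧ δ a ≤ j, D.edgeFlow p a

lemma lowerFlow_zero [Fintype V] (D : Digraph V) (p : V → ℝ) (δ : V → ℕ) :
    D.lowerFlow p δ 0 = 0 := by
  refine sum_eq_zero fun a ha => ?_
  simp only [mem_filter] at ha
  lia

lemma lowerFlow_succ [Fintype V] (D : Digraph V) (p : V → ℝ) (δ : V → ℕ) (j : ℕ) :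
    D.lowerFlow p δ (j + 1) = D.lowerFlow p δ j + D.levelFlow p δ (j + 1) := by
  rw [lowerFlow, lowerFlow, levelFlow, ← sum_union]
  · congr 1
    ext a
    simp only [mem_filter, mem_univ, true_and, mem_union]
    lia
  · rw [disjoint_filter]
    lia

lemma lowerFlow_nonneg [Fintype V] (hp : ∀ a, 0 < p a) (j : ℕ) : 0 ≤ D.lowerFlow p δ j :=
  sum_nonneg fun a _ => edgeFlow_nonneg hp a

lemma IsLevelFunction.lowerFlow_pos [Fintype V] (hδ : D.IsLevelFunction v δ)
    (h : ∀ a, ∃ b, D.Adj a b) (hp : ∀ a, 0 < p a) (hj : 1 ≤ j) (ha : j ≤ δ a) :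
    0 < D.lowerFlow p δ j := by
  obtain ⟨b, hb⟩ := hδ.exists_apply_eq ha
  exact sum_pos' (fun a _ => edgeFlow_nonneg hp a)
    ⟨b, by simp [hb, hj], edgeFlow_pos (h b) hp⟩

/-- The flow into `upperLevels δ (j + 1)`, split into the contribution of `v` and that of the
levels `1, …, j`. -/
lemma IsLevelFunction.flow_in_eq [Fintype V] (hδ : D.IsLevelFunction v δ) (p : V → ℝ) (j : ℕ) :
    ∑ a ∈ (upperLevels δ (j + 1))ᶜ,
        D.edgeFlow p a * #{b ∈ upperLevels δ (j + 1) | D.Adj a b} =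
      D.edgeFlow p v * #{b ∈ upperLevels δ (j + 1) | D.Adj v b} +
      ∑ a with 1 ≤ δ a ∧ δ a ≤ j,
        D.edgeFlow p a * #{b ∈ upperLevels δ (j + 1) | D.Adj a b} := by
  rw [← sum_insert (a := v) (s := {a | 1 ≤ δ a ∧ δ a ≤ j})
    (f := fun a => D.edgeFlow p a * #{b ∈ upperLevels δ (j + 1) | D.Adj a b})]
  · refine sum_congr ?_ fun _ _ => rfl
    ext a
    have := hδ.eq_zero_iff a
    simp only [mem_compl, mem_upperLevels, mem_insert, mem_filter, mem_univ, true_and, ← this]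
    lia
  · simp [hδ.apply_self]

/-- Each vertex at level `j + 1` has an edge to level `j`, so the flow at that level is at most the
flow out of the levels from `j + 1` upwards. -/
lemma IsLevelFunction.levelFlow_le_flow_in [Fintype V] (hδ : D.IsLevelFunction v δ)
    (h : ∀ a, ∃ b, D.Adj a b) (hp : ∀ a, 0 < p a) (hps : p ᵥ* D.transitionMatrix = p) (j : ℕ) :
    D.levelFlow p δ (j + 1) ≤
      ∑ a ∈ (upperLevels δ (j + 1))ᶜ,
        D.edgeFlow p a * #{b ∈ upperLevels δ (j + 1) | D.Adj a b} := by
  rw [← flow_out_eq_flow_in h hps, levelFlow]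
  have hsub : ({a | δ a = j + 1} : Finset V) ⊆ upperLevels δ (j + 1) := fun a ha => by
    simp only [mem_filter, mem_univ, true_and] at ha
    simp [ha]
  refine le_trans (sum_le_sum fun a ha => ?_) (sum_le_sum_of_subset_of_nonneg hsub
    fun a _ _ => mul_nonneg (edgeFlow_nonneg hp a) (Nat.cast_nonneg _))
  simp only [mem_filter, mem_univ, true_and] at ha
  have hav : a ≠ v := fun hav => by
    have := (hδ.eq_zero_iff a).2 hav
    lia
  obtain ⟨b, hab, hb⟩ := hδ.exists_adj a hav
  refine le_mul_of_one_le_right (edgeFlow_nonneg hp a) ?_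
  have : 0 < #{b ∈ (upperLevels δ (j + 1))ᶜ | D.Adj a b} :=
    card_pos.2 ⟨b, by simp [hab]; lia⟩
  exact_mod_cast this

lemma edgeFlow_mul_card_filter_le [Fintype V] (h : ∃ b, D.Adj a b) (hp : ∀ a, 0 < p a)
    (A : Finset V) : D.edgeFlow p a * #{b ∈ A | D.Adj a b} ≤ p a := by
  rw [← edgeFlow_mul_outDegree (p := p) h, outDegree_eq_card]
  exact mul_le_mul_of_nonneg_left
    (Nat.cast_le.2 (card_le_card (filter_subset_filter _ (subset_univ A)))) (edgeFlow_nonneg hp a)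

lemma sum_edgeFlow_mul_card_filter_le [Fintype V] (hp : ∀ a, 0 < p a) (A : Finset V) (j : ℕ) :
    ∑ a with 1 ≤ δ a ∧ δ a ≤ j, D.edgeFlow p a * #{b ∈ A | D.Adj a b} ≤
      #A * D.lowerFlow p δ j := by
  rw [lowerFlow, mul_sum]
  refine sum_le_sum fun a _ => ?_
  rw [mul_comm]
  exact mul_le_mul_of_nonneg_right (Nat.cast_le.2 (card_filter_le _ _)) (edgeFlow_nonneg hp a)

/-- The basic recursive estimate, from the cut below level `j + 1`. -/
lemma IsLevelFunction.levelFlow_succ_le [Fintype V] (hδ : D.IsLevelFunction v δ)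
    (h : ∀ a, ∃ b, D.Adj a b) (hp : ∀ a, 0 < p a) (hps : p ᵥ* D.transitionMatrix = p)
    (hj : j ≤ δ a) :
    D.levelFlow p δ (j + 1) ≤
      p v + ((Fintype.card V : ℝ) - (j + 1)) * D.lowerFlow p δ j := by
  have h1 := hδ.levelFlow_le_flow_in h hp hps j
  rw [hδ.flow_in_eq] at h1
  have h2 := edgeFlow_mul_card_filter_le (h v) hp (upperLevels δ (j + 1))
  have h3 := sum_edgeFlow_mul_card_filter_le (D := D) (δ := δ) hp (upperLevels δ (j + 1)) j
  have h4 : (#(upperLevels δ (j + 1)) : ℝ) + (j + 1) ≤ Fintype.card V := by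
    exact_mod_cast hδ.card_upperLevels_add_le (a := a) (j := j + 1) (by lia)
  have h5 := mul_le_mul_of_nonneg_right (le_sub_right_of_add_le h4)
    (lowerFlow_nonneg (D := D) (δ := δ) hp j)
  linarith

/-- The structure forced by equality in `IsLevelFunction.levelFlow_succ_le`. -/
lemma IsLevelFunction.adj_of_le_levelFlow_succ [Fintype V] (hδ : D.IsLevelFunction v δ)
    (h : ∀ a, ∃ b, D.Adj a b) (hp : ∀ a, 0 < p a) (hps : p ᵥ* D.transitionMatrix = p)
    (hj : j ≤ δ u)
    (heq : p v + ((Fintype.card V : ℝ) - (j + 1)) * D.lowerFlow p δ j ≤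
      D.levelFlow p δ (j + 1)) :
    (∀ b, D.Adj v b → j + 1 ≤ δ b) ∧
    (∀ a b, 1 ≤ δ a → δ a ≤ j → j + 1 ≤ δ b → D.Adj a b) ∧
    (1 ≤ j → #(upperLevels δ (j + 1)) + (j + 1) = Fintype.card V) := by
  have h1 := hδ.levelFlow_le_flow_in h hp hps j
  rw [hδ.flow_in_eq] at h1
  have h2 := edgeFlow_mul_card_filter_le (h v) hp (upperLevels δ (j + 1))
  have h3 := sum_edgeFlow_mul_card_filter_le (D := D) (δ := δ) hp (upperLevels δ (j + 1)) j
  have h4' := hδ.card_upperLevels_add_le (a := u) (j := j + 1) (by lia)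
  have h4 : (#(upperLevels δ (j + 1)) : ℝ) + (j + 1) ≤ Fintype.card V := by
    exact_mod_cast h4'
  have h5 := mul_le_mul_of_nonneg_right (le_sub_right_of_add_le h4)
    (lowerFlow_nonneg (D := D) (δ := δ) hp j)
  refine ⟨fun b hb => ?_, fun a b ha1 haj hb => ?_, fun hj1 => ?_⟩
  · have h6 : D.edgeFlow p v * #{b ∈ upperLevels δ (j + 1) | D.Adj v b} =
        D.edgeFlow p v * D.outDegree v := by
      rw [edgeFlow_mul_outDegree (h v)]
      linarith
    have h7 := mul_left_cancel₀ (edgeFlow_pos (h v) hp).ne' h6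
    rw [outDegree_eq_card, Nat.cast_inj] at h7
    have h8 := eq_of_subset_of_card_le
      (filter_subset_filter (fun b => D.Adj v b) (subset_univ (upperLevels δ (j + 1)))) h7.ge
    have : b ∈ ({b ∈ upperLevels δ (j + 1) | D.Adj v b} : Finset V) := by
      rw [h8]
      simpa using hb
    simpa using (mem_filter.1 this).1
  · have h6 : ∑ a with 1 ≤ δ a ∧ δ a ≤ j,
          D.edgeFlow p a * #{b ∈ upperLevels δ (j + 1) | D.Adj a b} =
        ∑ a with 1 ≤ δ a ∧ δ a ≤ j, D.edgeFlow p a * #(upperLevels δ (j + 1)) := by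
      rw [← sum_mul, mul_comm (∑ a with 1 ≤ δ a ∧ δ a ≤ j, D.edgeFlow p a)]
      change _ = _ * D.lowerFlow p δ j
      linarith
    have h7 := (sum_eq_sum_iff_of_le fun a _ => mul_le_mul_of_nonneg_left
      (Nat.cast_le.2 (card_filter_le _ _)) (edgeFlow_nonneg hp a)).1 h6 a (by simp [ha1, haj])
    have h8 := mul_left_cancel₀ (edgeFlow_pos (h a) hp).ne' h7
    rw [Nat.cast_inj, card_filter_eq_iff] at h8
    exact h8 b (by simpa using hb)
  · have hpos := hδ.lowerFlow_pos h hp hj1 hj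
    have h6 : (Fintype.card V : ℝ) - (j + 1) ≤ #(upperLevels δ (j + 1)) :=
      le_of_mul_le_mul_right (by linarith) hpos
    have h7 : (Fintype.card V : ℝ) ≤ (#(upperLevels δ (j + 1)) + (j + 1) : ℕ) := by
      push_cast
      linarith
    exact le_antisymm h4' (by exact_mod_cast h7)

end

/-! ### The sharp bound -/

/-- The largest possible value of `lowerFlow` up to level `j`, relative to the probability of `v`,
on a digraph with `n` vertices. -/
noncomputable def flowBound (n : ℕ) : ℕ → ℝ
  | 0 => 0
  | j + 1 => 1 + ((n : ℝ) - j) * flowBound n j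

/-- The bound on `p u / p v` for a vertex `u` at level `k + 1`. -/
noncomputable def ratioBound (n k : ℕ) : ℝ :=
  ((n : ℝ) - (k + 1)) * (1 + ((n : ℝ) - (k + 1)) * flowBound n k)

lemma flowBound_nonneg {n j : ℕ} (hj : j ≤ n) : 0 ≤ flowBound n j := by
  induction j with
  | zero => exact le_rfl
  | succ j ih =>
    have h1 : (j : ℝ) + 1 ≤ n := by exact_mod_cast hj
    have := mul_nonneg (by linarith : (0 : ℝ) ≤ n - j) (ih (by lia))
    rw [flowBound]
    linarith

lemma flowBound_mul_factorial (m j : ℕ) :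
    flowBound (m + j) j * (m ! : ℝ) = ∑ l ∈ Ico m (m + j), (l ! : ℝ) := by
  induction j generalizing m with
  | zero => simp [flowBound]
  | succ j ih =>
    have h := ih (m + 1)
    rw [sum_eq_sum_Ico_succ_bot (by lia), show m + (j + 1) = m + 1 + j by ring, ← h, flowBound,
      Nat.factorial_succ]
    push_cast
    ring

/-- `ratioBound (k + 3) k` is the closed form of the largest principal ratio on `k + 3`
vertices. -/
lemma ratioBound_eq_closedForm {n k : ℕ} (hn : n = k + 3) :
    2 / 3 * ((n : ℝ) / ((n : ℝ) - 1) +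
        1 / ((n - 1)! : ℝ) * ∑ i ∈ Finset.Icc 1 (n - 3), (i ! : ℝ)) * ((n - 1)! : ℝ) =
      ratioBound n k := by
  subst hn
  have h1 := flowBound_mul_factorial 3 k
  have h2 : ∑ l ∈ Ico 1 (k + 3), (l ! : ℝ) = 3 + ∑ l ∈ Ico 3 (k + 3), (l ! : ℝ) := by
    rw [sum_eq_sum_Ico_succ_bot (by lia), sum_eq_sum_Ico_succ_bot (by lia)]
    norm_num [Nat.factorial]
    ring
  have h3 : ∑ l ∈ Ico 1 (k + 3), (l ! : ℝ) =
      ∑ l ∈ Ico 1 (k + 1), (l ! : ℝ) + ((k + 1)! : ℝ) + ((k + 2)! : ℝ) := by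
    rw [sum_Ico_succ_top (by lia), sum_Ico_succ_top (by lia)]
  have h4 : Finset.Icc 1 (k + 3 - 3) = Ico 1 (k + 1) := by
    ext i
    simp only [mem_Icc, mem_Ico]
    lia
  have h5 : ((k + 2)! : ℝ) = (k + 2) * ((k + 1)! : ℝ) := by
    rw [Nat.factorial_succ]
    push_cast
    ring
  have h6 : (k : ℝ) + 2 ≠ 0 := by positivity
  have h7 : ((k + 1)! : ℝ) ≠ 0 := by positivity
  rw [h4, show k + 3 - 1 = k + 2 by lia, ratioBound]
  rw [add_comm 3 k, show (3 ! : ℝ) = 6 by norm_num [Nat.factorial]] at h1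
  rw [h2] at h3
  rw [h5] at h3 ⊢
  push_cast
  rw [show (k : ℝ) + 3 - 1 = k + 2 by ring, show (k : ℝ) + 3 - (k + 1) = 2 by ring]
  field_simp
  linarith

lemma ratioBound_lt_succ {n k : ℕ} (h : k + 4 ≤ n) : ratioBound n k < ratioBound n (k + 1) := by
  have ht := flowBound_nonneg (n := n) (j := k) (by lia)
  simp only [ratioBound, flowBound]
  push_cast
  obtain ⟨m, rfl⟩ := Nat.exists_eq_add_of_le h
  push_cast
  rw [show (k : ℝ) + 4 + m - (k + 1) = m + 3 by ring,
    show (k : ℝ) + 4 + m - (k + 1 + 1) = m + 2 by ring,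
    show (k : ℝ) + 4 + m - k = m + 4 by ring]
  set t := flowBound (k + 4 + m) k
  have hm : (0 : ℝ) ≤ m := Nat.cast_nonneg m
  have h1 : 0 ≤ ((m + 2) * (m + 2) * (m + 4) - (m + 3) * (m + 3) : ℝ) * t :=
    mul_nonneg (by nlinarith [mul_nonneg hm hm, mul_nonneg hm (mul_nonneg hm hm)]) ht
  nlinarith [mul_nonneg hm hm]

lemma ratioBound_lt {n k i : ℕ} (hn : n = k + 3) (hi : i < k) :
    ratioBound n i < ratioBound n k := by
  have : ∀ j, i + 1 + j ≤ k → ratioBound n i < ratioBound n (i + 1 + j) := by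
    intro j
    induction j with
    | zero => exact fun h => ratioBound_lt_succ (by lia)
    | succ j ih => exact fun h => (ih (by lia)).trans (ratioBound_lt_succ (by lia))
  obtain ⟨j, rfl⟩ := Nat.exists_eq_add_of_le (Nat.succ_le_of_lt hi)
  exact this j le_rfl

lemma ratioBound_succ_le {n k : ℕ} (hn : n = k + 3) :
    ratioBound n (k + 1) ≤ ratioBound n k := by
  have ht := flowBound_nonneg (n := n) (j := k) (by lia)
  simp only [ratioBound, flowBound, hn] at ht ⊢
  push_cast
  ring_nf at ht ⊢
  linarith

lemma one_lt_ratioBound {n k : ℕ} (hn : n = k + 3) : 1 < ratioBound n k := by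
  have ht := flowBound_nonneg (n := n) (j := k) (by lia)
  simp only [ratioBound, hn] at ht ⊢
  push_cast
  ring_nf at ht ⊢
  linarith

section

open scoped Classical

variable {V : Type*} [Fintype V] {D : Digraph V} {p : V → ℝ} {δ : V → ℕ} {a b u v : V} {j k : ℕ}

lemma IsLevelFunction.apply_lt_card (hδ : D.IsLevelFunction v δ) (a : V) :
    δ a < Fintype.card V := by
  have h := hδ.card_upperLevels_add_le (a := a) (j := δ a) (by lia)
  have := card_pos.2 ⟨a, (mem_upperLevels (δ := δ) (a := a)).2 le_rfl⟩
  lia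

lemma IsLevelFunction.lowerFlow_le (hδ : D.IsLevelFunction v δ) (h : ∀ a, ∃ b, D.Adj a b)
    (hp : ∀ a, 0 < p a) (hps : p ᵥ* D.transitionMatrix = p) (hj : j ≤ δ a) :
    D.lowerFlow p δ j ≤ flowBound (Fintype.card V) j * p v := by
  induction j with
  | zero => simp [lowerFlow_zero, flowBound]
  | succ j ih =>
    have h1 := hδ.levelFlow_succ_le h hp hps (a := a) (j := j) (by lia)
    have h2 : (j : ℝ) ≤ Fintype.card V := by
      have := hδ.apply_lt_card a
      exact_mod_cast (by lia : j ≤ Fintype.card V)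
    have h3 := mul_le_mul_of_nonneg_left (ih (by lia)) (sub_nonneg.2 h2)
    rw [lowerFlow_succ, flowBound]
    linarith

/-- If the bound on `lowerFlow` is attained at one level, it is attained at all levels below, and
so is the recursive estimate from which it comes. -/
lemma IsLevelFunction.le_levelFlow_succ_of_le_lowerFlow (hδ : D.IsLevelFunction v δ)
    (h : ∀ a, ∃ b, D.Adj a b) (hp : ∀ a, 0 < p a) (hps : p ᵥ* D.transitionMatrix = p)
    (hk : k ≤ δ a) (hle : flowBound (Fintype.card V) k * p v ≤ D.lowerFlow p δ k) (hj : j < k) :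
    p v + ((Fintype.card V : ℝ) - (j + 1)) * D.lowerFlow p δ j ≤ D.levelFlow p δ (j + 1) := by
  induction k with
  | zero => lia
  | succ k ih =>
    have h1 := hδ.levelFlow_succ_le h hp hps (a := a) (j := k) (by lia)
    have h2 : (k : ℝ) < Fintype.card V := by
      have := hδ.apply_lt_card a
      exact_mod_cast (by lia : k < Fintype.card V)
    have h3 := mul_le_mul_of_nonneg_left
      (hδ.lowerFlow_le h hp hps (a := a) (j := k) (by lia)) (sub_pos.2 h2).le
    rw [lowerFlow_succ, flowBound] at hle
    rcases Nat.lt_succ_iff_lt_or_eq.1 hj with hjk | rfl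
    · exact ih (by lia) (le_of_mul_le_mul_left (by linarith) (sub_pos.2 h2)) hjk
    · linarith

lemma edgeFlow_le_levelFlow (hp : ∀ a, 0 < p a) (ha : δ a = j) :
    D.edgeFlow p a ≤ D.levelFlow p δ j :=
  single_le_sum (f := fun a => D.edgeFlow p a) (fun b _ => edgeFlow_nonneg hp b)
    (by simp [ha])

lemma IsLevelFunction.le_ratioBound_mul (hδ : D.IsLevelFunction v δ) (hs : D.IsSimple)
    (h : ∀ a, ∃ b, D.Adj a b) (hp : ∀ a, 0 < p a) (hps : p ᵥ* D.transitionMatrix = p)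
    (hu : δ u = j + 1) : p u ≤ ratioBound (Fintype.card V) j * p v := by
  have h1 := hδ.levelFlow_succ_le h hp hps (a := u) (j := j) (by lia)
  have h2 := hδ.lowerFlow_le h hp hps (a := u) (j := j) (by lia)
  have h3 : (D.outDegree u : ℝ) ≤ Fintype.card V - (j + 1) := by
    have : (D.outDegree u : ℝ) + (j + 1) ≤ Fintype.card V := by
      exact_mod_cast hδ.outDegree_add_le hs hu
    linarith
  have h0 : (0 : ℝ) ≤ Fintype.card V - (j + 1) := (Nat.cast_nonneg _).trans h3
  have h4 := edgeFlow_le_levelFlow (D := D) hp hu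
  have h5 := mul_le_mul_of_nonneg_left h2 h0
  calc p u = D.edgeFlow p u * D.outDegree u := (edgeFlow_mul_outDegree (h u)).symm
    _ ≤ ((1 + (Fintype.card V - (j + 1)) * flowBound (Fintype.card V) j) * p v) *
        (Fintype.card V - (j + 1)) :=
      mul_le_mul (by linarith) h3 (Nat.cast_nonneg _)
        ((edgeFlow_nonneg hp u).trans (by linarith : D.edgeFlow p u ≤ _))
    _ = _ := by
      rw [ratioBound]
      ring

/-- The bound increases up to level `card V - 2`, and does not exceed that value at the last
possible level. -/
lemma le_ratioBound_mul (hk : Fintype.card V = k + 3) (hs : D.IsSimple)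
    (hD : D.IsStronglyConnected) (h : ∀ a, ∃ b, D.Adj a b) (hp : ∀ a, 0 < p a)
    (hps : p ᵥ* D.transitionMatrix = p) (u v : V) :
    p u ≤ ratioBound (Fintype.card V) k * p v := by
  obtain ⟨δ, hδ⟩ := exists_isLevelFunction hD v
  rcases Nat.eq_zero_or_eq_succ_pred (δ u) with h0 | hj
  · rw [(hδ.eq_zero_iff u).1 h0]
    exact le_mul_of_one_le_left (hp v).le (one_lt_ratioBound hk).le
  · refine (hδ.le_ratioBound_mul hs h hp hps hj).trans
      (mul_le_mul_of_nonneg_right ?_ (hp v).le)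
    have := hδ.apply_lt_card u
    rcases lt_trichotomy (δ u).pred k with hlt | heq | hgt
    · exact (ratioBound_lt hk hlt).le
    · rw [heq]
    · rw [show (δ u).pred = k + 1 by lia]
      exact ratioBound_succ_le hk

/-! ### The case of equality -/

/-- The labelling `δ` exhibits `D` as one of the extremal digraphs: the labels are
`card V - 1, …, 0` along the path, so `0` is the label of the last vertex of the path. -/
structure IsExtremalLabelling (D : Digraph V) (δ : V → ℕ) : Prop where
  injective : Function.Injective δ
  lt_card : ∀ a, δ a < Fintype.card V
  adj_iff : ∀ a b, 1 ≤ δ a → (D.Adj a b ↔ δ a = δ b + 1 ∨ δ a < δ b)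
  le_of_adj : ∀ a b, δ a = 0 → D.Adj a b → Fintype.card V ≤ δ b + 2
  exists_adj : ∀ a, δ a = 0 → ∃ b, D.Adj a b

lemma IsLevelFunction.isExtremalLabelling (hδ : D.IsLevelFunction v δ)
    (hk : Fintype.card V = k + 3) (hs : D.IsSimple)
    (h : ∀ a, ∃ b, D.Adj a b) (hp : ∀ a, 0 < p a) (hps : p ᵥ* D.transitionMatrix = p)
    (hu : δ u = k + 1) (hle : ratioBound (Fintype.card V) k * p v ≤ p u) :
    D.IsExtremalLabelling δ := by
  have hcast : (Fintype.card V : ℝ) - (k + 1) = 2 := by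
    rw [hk]
    push_cast
    ring
  have h1 := hδ.levelFlow_succ_le h hp hps (a := u) (j := k) (by lia)
  have h2 := hδ.lowerFlow_le h hp hps (a := u) (j := k) (by lia)
  have h3 : D.outDegree u ≤ 2 := by
    have := hδ.outDegree_add_le hs hu
    lia
  have h4 := edgeFlow_le_levelFlow (D := D) hp hu
  have hupos := edgeFlow_pos (h u) hp
  have h5 := edgeFlow_mul_outDegree (p := p) (h u)
  have h6 := mul_le_mul_of_nonneg_left (Nat.cast_le (α := ℝ).2 h3) hupos.le
  rw [ratioBound, hcast] at hle
  rw [hcast] at h1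
  push_cast at h6
  have hflow : flowBound (Fintype.card V) k * p v ≤ D.lowerFlow p δ k := by linarith
  have hdeg : D.outDegree u = 2 := by
    refine le_antisymm h3 ?_
    have : D.edgeFlow p u * 2 ≤ D.edgeFlow p u * D.outDegree u := by linarith
    exact_mod_cast le_of_mul_le_mul_left this hupos
  have hlevel : ∀ a, δ a = k + 1 → a = u := by
    intro a ha
    by_contra hne
    have hsub : ({a, u} : Finset V) ⊆ ({b | δ b = k + 1} : Finset V) := by
      intro b hb
      rcases mem_insert.1 hb with rfl | hb
      · simpa using ha
      · rw [mem_singleton.1 hb]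
        simpa using hu
    have h7 := sum_le_sum_of_subset_of_nonneg hsub
      (f := fun b => D.edgeFlow p b) (fun b _ _ => edgeFlow_nonneg hp b)
    rw [sum_pair hne] at h7
    change _ ≤ D.levelFlow p δ (k + 1) at h7
    linarith [edgeFlow_pos (h a) hp]
  have hsat : ∀ j, j ≤ k →
      p v + ((Fintype.card V : ℝ) - (j + 1)) * D.lowerFlow p δ j ≤ D.levelFlow p δ (j + 1) := by
    intro j hj
    rcases hj.lt_or_eq with hlt | rfl
    · exact hδ.le_levelFlow_succ_of_le_lowerFlow h hp hps (a := u) (by lia) hflow hlt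
    · rw [hcast]
      linarith
  have hstruct := fun j (hj : j ≤ k) =>
    hδ.adj_of_le_levelFlow_succ h hp hps (u := u) (j := j) (by lia) (hsat j hj)
  -- Besides `u` there is exactly one more vertex in the levels from `k + 1` upwards.
  have hcard : #(upperLevels δ (k + 1)) = 2 := by
    rcases Nat.eq_zero_or_pos k with rfl | hkpos
    · have : upperLevels δ (0 + 1) = univ.erase v := by
        ext a
        have := hδ.eq_zero_iff a
        simp only [mem_upperLevels, mem_erase, mem_univ, and_true, Ne, ← this]
        lia
      rw [this, card_erase_of_mem (mem_univ v), card_univ, hk]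
    · have := (hstruct k le_rfl).2.2 hkpos
      lia
  obtain ⟨x, hx, hxu⟩ := exists_mem_ne (by lia : 1 < #(upperLevels δ (k + 1))) u
  have hδx : δ x = k + 2 := by
    have h7 := mem_upperLevels.1 hx
    have h8 := hδ.apply_lt_card x
    have h9 : δ x ≠ k + 1 := fun h => hxu (hlevel x h)
    lia
  have hinj : Function.Injective δ := by
    let δ' : V → Fin (Fintype.card V) := fun a => ⟨δ a, hδ.apply_lt_card a⟩
    have hsurj : Function.Surjective δ' := fun i => by
      obtain ⟨b, hb⟩ := hδ.exists_apply_eq (a := x) (j := i) (by lia)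
      exact ⟨b, Fin.ext hb⟩
    have hbij := (Fintype.bijective_iff_surjective_and_card δ').2 ⟨hsurj, by simp⟩
    exact fun a b hab => hbij.1 (Fin.ext hab)
  refine ⟨hinj, hδ.apply_lt_card, fun a b ha => ⟨fun hab => ?_, fun hab => ?_⟩,
    fun a b ha hab => ?_, fun a _ => h a⟩
  · have h7 := hδ.le_succ a b hab
    have h8 : δ a ≠ δ b := fun heq => by
      rw [hinj heq] at hab
      exact hs b hab
    lia
  · rcases hab with hab | hab
    · have hav : a ≠ v := fun hav => by
        have := (hδ.eq_zero_iff a).2 hav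
        lia
      obtain ⟨c, hac, hc⟩ := hδ.exists_adj a hav
      rwa [hinj (by lia : δ b = δ c)]
    · have h7 := hδ.apply_lt_card b
      rcases le_or_gt (δ a) k with hak | hak
      · exact (hstruct (δ a) hak).2.1 a b ha le_rfl hab
      · obtain rfl : a = u := hlevel a (by lia)
        by_contra hnot
        -- Without an edge to the top level, `u` would have a single out-neighbour.
        have h8 : #({c | D.Adj a c} : Finset V) ≤ 1 := by
          refine card_le_one.2 fun c hc d hd => ?_
          simp only [mem_filter, mem_univ, true_and] at hc hd
          have key : ∀ e, D.Adj a e → δ e = k := fun e he => by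
            have h9 := hδ.le_succ a e he
            have h10 := hδ.apply_lt_card e
            have h11 : e ≠ a := fun hea => hs a (hea ▸ he)
            have h12 : δ e ≠ δ a := fun heq => h11 (hinj heq)
            have h13 : δ e ≠ δ b := fun heq => hnot (hinj heq ▸ he)
            lia
          exact hinj (by rw [key c hc, key d hd])
        rw [← outDegree_eq_card] at h8
        lia
  · obtain rfl := (hδ.eq_zero_iff a).1 ha
    have := (hstruct k le_rfl).1 b hab
    lia

/-- A vertex at the last possible level `card V - 1` has a single out-neighbour, which is then at
least as probable, so that equality has to be studied at level `card V - 2` only. -/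
lemma exists_isExtremalLabelling (hk : Fintype.card V = k + 3) (hs : D.IsSimple)
    (hD : D.IsStronglyConnected) (h : ∀ a, ∃ b, D.Adj a b) (hp : ∀ a, 0 < p a)
    (hps : p ᵥ* D.transitionMatrix = p)
    (hle : ratioBound (Fintype.card V) k * p v ≤ p u) :
    ∃ δ, D.IsExtremalLabelling δ := by
  obtain ⟨δ, hδ⟩ := exists_isLevelFunction hD v
  refine ⟨δ, ?_⟩
  rcases Nat.eq_zero_or_eq_succ_pred (δ u) with h0 | hj
  · rw [(hδ.eq_zero_iff u).1 h0] at hle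
    have := (lt_mul_iff_one_lt_left (hp v)).2 (one_lt_ratioBound hk)
    linarith
  · have hlt := hδ.apply_lt_card u
    have hbound := hδ.le_ratioBound_mul hs h hp hps hj
    rcases lt_trichotomy (δ u).pred k with hlt | heq | hgt
    · have := mul_lt_mul_of_pos_right (ratioBound_lt hk hlt) (hp v)
      linarith
    · exact hδ.isExtremalLabelling hk hs h hp hps (u := u) (by lia) hle
    · have huv : u ≠ v := fun huv => by
        have := (hδ.eq_zero_iff u).2 huv
        lia
      obtain ⟨w, huw, hw⟩ := hδ.exists_adj u huv
      have hdeg : D.outDegree u = 1 := by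
        have := hδ.outDegree_add_le hs (j := k + 1) (a := u) (by lia)
        have := outDegree_pos (h u)
        lia
      have hpw : p u ≤ p w := by
        rw [← sum_mul_transitionMatrix hps w]
        have h1 : p u * D.transitionMatrix u w = p u := by simp [transitionMatrix, huw, hdeg]
        calc p u = p u * D.transitionMatrix u w := h1.symm
          _ ≤ _ := single_le_sum (f := fun a => p a * D.transitionMatrix a w)
            (fun a _ => mul_nonneg (hp a).le (transitionMatrix_nonneg D a w)) (mem_univ u)
      exact hδ.isExtremalLabelling hk hs h hp hps (u := w) (by lia) (hle.trans hpw)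

/-! ### The ratio attained by the extremal digraphs -/

lemma IsExtremalLabelling.exists_apply_eq (hδ : D.IsExtremalLabelling δ)
    (hj : j < Fintype.card V) : ∃ a, δ a = j := by
  let δ' : V → Fin (Fintype.card V) := fun a => ⟨δ a, hδ.lt_card a⟩
  have hbij := (Fintype.bijective_iff_injective_and_card δ').2
    ⟨fun a b hab => hδ.injective (Fin.val_eq_of_eq hab), by simp⟩
  obtain ⟨a, ha⟩ := hbij.2 ⟨j, hj⟩
  exact ⟨a, Fin.val_eq_of_eq ha⟩

lemma IsExtremalLabelling.isSimple (hδ : D.IsExtremalLabelling δ)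
    (hk : Fintype.card V = k + 3) : D.IsSimple := by
  intro a ha
  rcases Nat.eq_zero_or_pos (δ a) with h0 | hpos
  · have := hδ.le_of_adj a a h0 ha
    lia
  · have := (hδ.adj_iff a a hpos).1 ha
    lia

lemma IsExtremalLabelling.isLevelFunction (hδ : D.IsExtremalLabelling δ) (hv : δ v = 0) :
    D.IsLevelFunction v δ := by
  refine ⟨fun a => ⟨fun ha => hδ.injective (ha.trans hv.symm), fun ha => ha ▸ hv⟩,
    fun a b hab => ?_, fun a ha => ?_⟩
  · rcases Nat.eq_zero_or_pos (δ a) with h0 | hpos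
    · lia
    · have := (hδ.adj_iff a b hpos).1 hab
      lia
  · have hpos : 1 ≤ δ a := by
      by_contra! hlt
      exact ha (hδ.injective (by lia))
    obtain ⟨b, hb⟩ := hδ.exists_apply_eq (j := δ a - 1) (by have := hδ.lt_card a; lia)
    exact ⟨b, (hδ.adj_iff a b hpos).2 (by lia), by lia⟩

/-- All walks lead down to label `0`, from there to the top label `card V - 1`, and from there
down through all the labels. -/
lemma IsExtremalLabelling.isStronglyConnected (hδ : D.IsExtremalLabelling δ)
    (hk : Fintype.card V = k + 3) : D.IsStronglyConnected := by
  have hdown : ∀ m a b, δ a = δ b + m → Relation.ReflTransGen D.Adj a b := by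
    intro m
    induction m with
    | zero =>
      intro a b hab
      rw [hδ.injective (hab : δ a = δ b)]
    | succ m ih =>
      intro a b hab
      obtain ⟨c, hc⟩ := hδ.exists_apply_eq (j := δ a - 1) (by have := hδ.lt_card a; lia)
      exact (ih c b (by lia)).head ((hδ.adj_iff a c (by lia)).2 (by lia))
  obtain ⟨v, hv⟩ := hδ.exists_apply_eq (j := 0) (by lia)
  obtain ⟨x, hx⟩ := hδ.exists_apply_eq (j := k + 2) (by lia)
  have hvx : Relation.ReflTransGen D.Adj v x := by
    obtain ⟨c, hvc⟩ := hδ.exists_adj v hv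
    have h1 := hδ.le_of_adj v c hv hvc
    have h2 := hδ.lt_card c
    by_cases hcx : δ c = δ x
    · rw [← hδ.injective hcx]
      exact .single hvc
    · exact (Relation.ReflTransGen.single hvc).tail ((hδ.adj_iff c x (by lia)).2 (by lia))
  intro a b
  have h2 := hδ.lt_card b
  exact ((hdown (δ a) a v (by lia)).trans hvx).trans (hdown (k + 2 - δ b) x b (by lia))

lemma IsExtremalLabelling.card_upperLevels (hδ : D.IsExtremalLabelling δ) (j : ℕ) :
    #(upperLevels δ j) = Fintype.card V - j := by
  have : (upperLevels δ j).image δ = Ico j (Fintype.card V) := by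
    ext i
    simp only [mem_image, mem_upperLevels, mem_Ico]
    constructor
    · rintro ⟨a, ha, rfl⟩
      exact ⟨ha, hδ.lt_card a⟩
    · rintro ⟨h1, h2⟩
      obtain ⟨a, rfl⟩ := hδ.exists_apply_eq h2
      exact ⟨a, h1, rfl⟩
  rw [← card_image_of_injective _ hδ.injective, this, Nat.card_Ico]

/-- All the estimates in the proof of the recursive bound are equalities here. -/
lemma IsExtremalLabelling.levelFlow_succ_eq (hδ : D.IsExtremalLabelling δ)
    (hk : Fintype.card V = k + 3) (hv : δ v = 0) (h : ∀ a, ∃ b, D.Adj a b)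
    (hps : p ᵥ* D.transitionMatrix = p) (hj : j ≤ k) :
    D.levelFlow p δ (j + 1) =
      p v + ((Fintype.card V : ℝ) - (j + 1)) * D.lowerFlow p δ j := by
  have hflow := flow_out_eq_flow_in h hps (upperLevels δ (j + 1))
  rw [(hδ.isLevelFunction hv).flow_in_eq] at hflow
  have hout : ∑ a ∈ upperLevels δ (j + 1),
      D.edgeFlow p a * #{b ∈ (upperLevels δ (j + 1))ᶜ | D.Adj a b} =
        D.levelFlow p δ (j + 1) := by
    have hsub : ({a | δ a = j + 1} : Finset V) ⊆ upperLevels δ (j + 1) := fun a ha => by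
      simp only [mem_filter, mem_univ, true_and] at ha
      simp [ha]
    rw [levelFlow, ← sum_subset hsub]
    · refine sum_congr rfl fun a ha => ?_
      simp only [mem_filter, mem_univ, true_and] at ha
      obtain ⟨c, hc⟩ := hδ.exists_apply_eq (j := j) (by lia)
      have : ({b ∈ (upperLevels δ (j + 1))ᶜ | D.Adj a b} : Finset V) = {c} := by
        ext b
        simp only [mem_filter, mem_compl, mem_upperLevels, mem_singleton,
          hδ.adj_iff a b (by lia), ← hδ.injective.eq_iff (a := b)]
        lia
      rw [this, card_singleton, Nat.cast_one, mul_one]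
    · intro a ha hne
      simp only [mem_upperLevels, mem_filter, mem_univ, true_and] at ha hne
      have : ({b ∈ (upperLevels δ (j + 1))ᶜ | D.Adj a b} : Finset V) = ∅ := by
        ext b
        simp only [mem_filter, mem_compl, mem_upperLevels, hδ.adj_iff a b (by lia), notMem_empty]
        lia
      rw [this, card_empty, Nat.cast_zero, mul_zero]
  have hbot : D.edgeFlow p v * #{b ∈ upperLevels δ (j + 1) | D.Adj v b} = p v := by
    have : ({b ∈ upperLevels δ (j + 1) | D.Adj v b} : Finset V) =
        ({b | D.Adj v b} : Finset V) := by
      ext b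
      simp only [mem_filter, mem_upperLevels, mem_univ, true_and, and_iff_right_iff_imp]
      intro hvb
      have := hδ.le_of_adj v b hv hvb
      lia
    rw [this, ← outDegree_eq_card, edgeFlow_mul_outDegree (h v)]
  have hmid : ∑ a with 1 ≤ δ a ∧ δ a ≤ j,
      D.edgeFlow p a * #{b ∈ upperLevels δ (j + 1) | D.Adj a b} =
        ((Fintype.card V : ℝ) - (j + 1)) * D.lowerFlow p δ j := by
    rw [lowerFlow, mul_sum]
    refine sum_congr rfl fun a ha => ?_
    simp only [mem_filter, mem_univ, true_and] at ha
    have : ({b ∈ upperLevels δ (j + 1) | D.Adj a b} : Finset V) = upperLevels δ (j + 1) := by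
      ext b
      simp only [mem_filter, mem_upperLevels, hδ.adj_iff a b ha.1]
      lia
    rw [this, hδ.card_upperLevels, Nat.cast_sub (by lia)]
    push_cast
    ring
  linarith

lemma IsExtremalLabelling.exists_eq_ratioBound_mul (hδ : D.IsExtremalLabelling δ)
    (hk : Fintype.card V = k + 3) (h : ∀ a, ∃ b, D.Adj a b)
    (hps : p ᵥ* D.transitionMatrix = p) :
    ∃ u v, p u = ratioBound (Fintype.card V) k * p v := by
  obtain ⟨v, hv⟩ := hδ.exists_apply_eq (j := 0) (by lia)
  obtain ⟨u, hu⟩ := hδ.exists_apply_eq (j := k + 1) (by lia)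
  have hlower : ∀ j ≤ k, D.lowerFlow p δ j = flowBound (Fintype.card V) j * p v := by
    intro j
    induction j with
    | zero => simp [lowerFlow_zero, flowBound]
    | succ j ih =>
      intro hj
      rw [lowerFlow_succ, hδ.levelFlow_succ_eq hk hv h hps (by lia), ih (by lia), flowBound]
      ring
  have hlevel : D.levelFlow p δ (k + 1) = D.edgeFlow p u := by
    have : ({a | δ a = k + 1} : Finset V) = {u} := by
      ext a
      simp only [mem_filter, mem_univ, true_and, mem_singleton]
      rw [← hu, hδ.injective.eq_iff]
    rw [levelFlow, this, sum_singleton]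
  have hdeg : D.outDegree u = 2 := by
    have : ({b | D.Adj u b} : Finset V).image δ = {k, k + 2} := by
      ext i
      simp only [mem_image, mem_filter, mem_univ, true_and, mem_insert, mem_singleton]
      constructor
      · rintro ⟨b, hb, rfl⟩
        have := (hδ.adj_iff u b (by lia)).1 hb
        have := hδ.lt_card b
        lia
      · intro hi
        obtain ⟨b, rfl⟩ := hδ.exists_apply_eq (j := i) (by lia)
        exact ⟨b, (hδ.adj_iff u b (by lia)).2 (by lia), rfl⟩
    rw [outDegree_eq_card, ← card_image_of_injective _ hδ.injective, this, card_pair (by lia)]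
  refine ⟨u, v, ?_⟩
  rw [← edgeFlow_mul_outDegree (p := p) (h u), ← hlevel, hδ.levelFlow_succ_eq hk hv h hps le_rfl,
    hlower k le_rfl, hdeg, ratioBound, hk]
  push_cast
  ring

end

section

variable {V : Type*} [Fintype V] {D : Digraph V} {δ : V → ℕ} {n k : ℕ} {S : Set ℕ}

/-! ### Extremal labellings as isomorphisms -/

/-- The vertex with index `i` on the path gets the label `n - 1 - i`. -/
lemma exists_isExtremalLabelling_of_iso (hV : Fintype.card V = n) (hn : 3 ≤ n)
    (hS : ∀ i ∈ S, i ≤ 1) (hne : S.Nonempty) (h : D.IsIsomorphic (pathWithBackEdges n S)) :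
    ∃ δ, D.IsExtremalLabelling δ := by
  obtain ⟨e⟩ := h
  have hadj : ∀ a b, D.Adj a b ↔ (e a : ℕ) + 1 = (e b : ℕ) ∨
      ((e b : ℕ) < (e a : ℕ) ∧ (e a : ℕ) + 1 < n) ∨ ((e a : ℕ) + 1 = n ∧ (e b : ℕ) ∈ S) :=
    fun a b => (e.map_rel_iff (a := a) (b := b)).symm
  refine ⟨fun a => n - 1 - (e a : ℕ), fun a b hab => ?_, fun a => ?_, fun a b ha => ?_,
    fun a b ha hab => ?_, fun a ha => ?_⟩
  · have h1 := (e a).isLt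
    have h2 := (e b).isLt
    exact e.injective (Fin.ext (by lia))
  · lia
  · have h1 := (e a).isLt
    have h2 := (e b).isLt
    rw [hadj]
    constructor
    · rintro (h3 | h3 | h3) <;> lia
    · rintro (h3 | h3)
      · exact Or.inl (by lia)
      · exact Or.inr (Or.inl (by lia))
  · have h1 := (e a).isLt
    have h2 := (e b).isLt
    rcases (hadj a b).1 hab with h3 | h3 | h3
    · lia
    · lia
    · have := hS _ h3.2
      lia
  · obtain ⟨i, hi⟩ := hne
    have h1 := (e a).isLt
    have h2 := hS i hi
    refine ⟨e.symm ⟨i, by lia⟩, (hadj _ _).2 (Or.inr (Or.inr ⟨by lia, ?_⟩))⟩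
    simpa using hi

lemma IsExtremalLabelling.isIsomorphic (hδ : D.IsExtremalLabelling δ)
    (hV : Fintype.card V = n) (hn : 3 ≤ n) :
    D.IsIsomorphic (extremal₁ n) ∨ D.IsIsomorphic (extremal₂ n) ∨
      D.IsIsomorphic (extremal₃ n) := by
  obtain ⟨v, hv⟩ := hδ.exists_apply_eq (j := 0) (by lia)
  let S : Set ℕ := {i | ∃ b, D.Adj v b ∧ δ b + i + 1 = n}
  let f : V → Fin n := fun a => ⟨n - 1 - δ a, by lia⟩
  have hf : Function.Bijective f := by
    refine (Fintype.bijective_iff_injective_and_card f).2 ⟨fun a b hab => ?_, by simp [hV]⟩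
    have h1 := hδ.lt_card a
    have h2 := hδ.lt_card b
    have h3 := Fin.val_eq_of_eq hab
    exact hδ.injective (by simp only [f] at h3; lia)
  have hiso : D.IsIsomorphic (pathWithBackEdges n S) := by
    refine ⟨Equiv.ofBijective f hf, ?_⟩
    intro a b
    have h1 := hδ.lt_card a
    have h2 := hδ.lt_card b
    simp only [pathWithBackEdges, Equiv.ofBijective_apply, f]
    rcases Nat.eq_zero_or_pos (δ a) with h0 | hpos
    · obtain rfl : a = v := hδ.injective (h0.trans hv.symm)
      constructor
      · rintro (h3 | h3 | ⟨-, c, hc, hcb⟩)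
        · lia
        · lia
        · rwa [hδ.injective (by lia : δ b = δ c)]
      · exact fun hab => Or.inr (Or.inr ⟨by lia, b, hab, by lia⟩)
    · rw [hδ.adj_iff a b hpos]
      constructor
      · rintro (h3 | h3 | h3) <;> lia
      · rintro (h3 | h3)
        · exact Or.inl (by lia)
        · exact Or.inr (Or.inl (by lia))
  have hS : ∀ i ∈ S, i = 0 ∨ i = 1 := by
    rintro i ⟨b, hb, hi⟩
    have := hδ.le_of_adj v b hv hb
    lia
  have hne : ∃ i, i ∈ S := by
    obtain ⟨b, hb⟩ := hδ.exists_adj v hv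
    have := hδ.lt_card b
    exact ⟨n - 1 - δ b, b, hb, by lia⟩
  by_cases h0 : 0 ∈ S <;> by_cases h1 : 1 ∈ S
  · have : S = {0, 1} := by
      ext i
      exact ⟨hS i, by rintro (rfl | rfl) <;> assumption⟩
    rw [this] at hiso
    exact Or.inr (Or.inr hiso)
  · have : S = {0} := by
      ext i
      exact ⟨fun hi => (hS i hi).resolve_right (fun h => h1 (h ▸ hi)), by rintro rfl; exact h0⟩
    rw [this] at hiso
    exact Or.inl hiso
  · have : S = {1} := by
      ext i
      exact ⟨fun hi => (hS i hi).resolve_left (fun h => h0 (h ▸ hi)), by rintro rfl; exact h1⟩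
    rw [this] at hiso
    exact Or.inr (Or.inl hiso)
  · obtain ⟨i, hi⟩ := hne
    rcases hS i hi with rfl | rfl
    · exact absurd hi h0
    · exact absurd hi h1

lemma exists_isExtremalLabelling_iff (hV : Fintype.card V = n) (hn : 3 ≤ n) :
    (∃ δ, D.IsExtremalLabelling δ) ↔
      (D.IsIsomorphic (extremal₁ n) ∨ D.IsIsomorphic (extremal₂ n) ∨
        D.IsIsomorphic (extremal₃ n)) := by
  constructor
  · rintro ⟨δ, hδ⟩
    exact hδ.isIsomorphic hV hn
  · rintro (h | h | h)
    · exact exists_isExtremalLabelling_of_iso hV hn (by simp) (by simp) h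
    · exact exists_isExtremalLabelling_of_iso hV hn (by simp) (by simp) h
    · exact exists_isExtremalLabelling_of_iso hV hn (by simp) (by simp) h

/-! ### The extremal digraphs are pairwise non-isomorphic -/

/-- The out-neighbours of `a` are `c` and nothing else. -/
def IsSoleOutNeighbour {V : Type*} (D : Digraph V) (a c : V) : Prop :=
  ∀ d, D.Adj a d ↔ d = c

lemma IsSoleOutNeighbour.map {V W : Type*} {D : Digraph V} {E : Digraph W} {a c : V}
    (h : D.IsSoleOutNeighbour a c) (e : D.Adj ≃r E.Adj) : E.IsSoleOutNeighbour (e a) (e c) := by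
  intro d
  rw [← e.apply_symm_apply d, e.map_rel_iff, h, e.apply_eq_iff_eq]

lemma isSoleOutNeighbour_first (hn : 3 ≤ n) (S : Set ℕ) :
    (pathWithBackEdges n S).IsSoleOutNeighbour ⟨0, by lia⟩ ⟨1, by lia⟩ := by
  intro d
  simp only [pathWithBackEdges, Fin.ext_iff]
  lia

lemma isSoleOutNeighbour_last (hn : 3 ≤ n) {i : ℕ} (hi : i < n) :
    (pathWithBackEdges n {i}).IsSoleOutNeighbour ⟨n - 1, by lia⟩ ⟨i, hi⟩ := by
  intro d
  simp only [pathWithBackEdges, Fin.ext_iff, Set.mem_singleton_iff]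
  lia

/-- A vertex `i` strictly between the first and the last one has the out-neighbours `0` and
`i + 1`. -/
lemma IsSoleOutNeighbour.eq_first_or_last (hn : 3 ≤ n) {a c : Fin n}
    (h : (pathWithBackEdges n S).IsSoleOutNeighbour a c) :
    ((a : ℕ) = 0 ∧ (c : ℕ) = 1) ∨
      ((a : ℕ) + 1 = n ∧ ∀ i ∈ S, i < n → i = (c : ℕ)) := by
  have ha := a.isLt
  by_cases hlast : (a : ℕ) + 1 = n
  · exact Or.inr ⟨hlast, fun i hi hin =>
      Fin.val_eq_of_eq ((h ⟨i, hin⟩).1 (Or.inr (Or.inr ⟨hlast, hi⟩)))⟩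
  · have h1 := Fin.val_eq_of_eq ((h ⟨a + 1, by lia⟩).1 (Or.inl rfl))
    by_cases h0 : (a : ℕ) = 0
    · exact Or.inl ⟨h0, by simp only at h1; lia⟩
    · have h2 := Fin.val_eq_of_eq
        ((h ⟨0, by lia⟩).1 (Or.inr (Or.inl ⟨by simp only; lia, by lia⟩)))
      simp only at h1 h2
      lia

lemma not_isIsomorphic_extremal₁_extremal₂ (hn : 3 ≤ n) :
    ¬ (extremal₁ n).IsIsomorphic (extremal₂ n) := by
  rw [extremal₁, extremal₂]
  rintro ⟨e⟩
  -- In `extremal₂`, the first and the last vertex have the same sole out-neighbour.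
  have h1 := ((isSoleOutNeighbour_first hn {1}).map e.symm).eq_first_or_last hn
  have h2 := ((isSoleOutNeighbour_last hn (i := 1) (by lia)).map e.symm).eq_first_or_last hn
  simp only [Set.mem_singleton_iff, forall_eq] at h1 h2
  have := Fin.val_eq_of_eq (e.symm.injective (Fin.ext (by lia)) :
    (⟨0, by lia⟩ : Fin n) = ⟨n - 1, by lia⟩)
  simp only at this
  lia

/-- In `extremal₃`, only the first vertex has a sole out-neighbour. -/
lemma not_isIsomorphic_extremal₃ (hn : 3 ≤ n) {i : ℕ} (hi : i < n) :
    ¬ (pathWithBackEdges n {i}).IsIsomorphic (extremal₃ n) := by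
  rw [extremal₃]
  rintro ⟨e⟩
  have h1 := ((isSoleOutNeighbour_first hn {i}).map e).eq_first_or_last hn
  have h2 := ((isSoleOutNeighbour_last hn hi).map e).eq_first_or_last hn
  simp only [Set.mem_insert_iff, Set.mem_singleton_iff, forall_eq_or_imp, forall_eq] at h1 h2
  have := Fin.val_eq_of_eq (e.injective (Fin.ext (by lia)) :
    (⟨0, by lia⟩ : Fin n) = ⟨n - 1, by lia⟩)
  simp only at this
  lia

/-! ### The principal ratio -/

lemma exists_principalRatio_eq [Nonempty V] (D : Digraph V) :
    ∃ u v, (∀ a, D.perronVector a ≤ D.perronVector u) ∧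
      (∀ a, D.perronVector v ≤ D.perronVector a) ∧
      D.principalRatio = D.perronVector u / D.perronVector v := by
  obtain ⟨u, hu⟩ := Finite.exists_max D.perronVector
  obtain ⟨v, hv⟩ := Finite.exists_min D.perronVector
  refine ⟨u, v, hu, hv, ?_⟩
  have hsup : ⨆ a, D.perronVector a = D.perronVector u :=
    le_antisymm (ciSup_le hu) (le_ciSup (Set.finite_range _).bddAbove u)
  have hinf : ⨅ a, D.perronVector a = D.perronVector v :=
    le_antisymm (ciInf_le (Set.finite_range _).bddBelow v) (le_ciInf hv)
  rw [principalRatio, hsup, hinf]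

lemma principalRatio_le (hk : Fintype.card V = k + 3) (hs : D.IsSimple)
    (hD : D.IsStronglyConnected) : D.principalRatio ≤ ratioBound (Fintype.card V) k := by
  have : Nontrivial V := Fintype.one_lt_card_iff_nontrivial.1 (by lia)
  have h := exists_adj_of_isStronglyConnected hD
  have hp := isStationaryDistribution_perronVector h
  obtain ⟨u, v, -, -, heq⟩ := D.exists_principalRatio_eq
  rw [heq, div_le_iff₀ (hp.pos hD v)]
  exact le_ratioBound_mul hk hs hD h (hp.pos hD) hp.stationary u v

lemma principalRatio_eq_iff (hk : Fintype.card V = k + 3) :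
    (D.IsSimple ∧ D.IsStronglyConnected ∧
      D.principalRatio = ratioBound (Fintype.card V) k) ↔ ∃ δ, D.IsExtremalLabelling δ := by
  have : Nontrivial V := Fintype.one_lt_card_iff_nontrivial.1 (by lia)
  constructor
  · rintro ⟨hs, hD, hratio⟩
    have h := exists_adj_of_isStronglyConnected hD
    have hp := isStationaryDistribution_perronVector h
    obtain ⟨u, v, -, -, heq⟩ := D.exists_principalRatio_eq
    rw [heq, div_eq_iff (hp.pos hD v).ne'] at hratio
    exact exists_isExtremalLabelling hk hs hD h (hp.pos hD) hp.stationary hratio.ge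
  · rintro ⟨δ, hδ⟩
    have hs := hδ.isSimple hk
    have hD := hδ.isStronglyConnected hk
    have h := exists_adj_of_isStronglyConnected hD
    have hp := isStationaryDistribution_perronVector h
    refine ⟨hs, hD, le_antisymm (principalRatio_le hk hs hD) ?_⟩
    obtain ⟨u, v, hu, hv, heq⟩ := D.exists_principalRatio_eq
    obtain ⟨u', v', heq'⟩ := hδ.exists_eq_ratioBound_mul hk h hp.stationary
    rw [heq, le_div_iff₀ (hp.pos hD v)]
    calc ratioBound (Fintype.card V) k * D.perronVector v
        ≤ ratioBound (Fintype.card V) k * D.perronVector v' :=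
          mul_le_mul_of_nonneg_left (hv v') (zero_le_one.trans (one_lt_ratioBound hk).le)
      _ = D.perronVector u' := heq'.symm
      _ ≤ D.perronVector u := hu u'

end

end Digraph

theorem theorem2 {V : Type*} [Fintype V] (n : ℕ) (hn : 3 ≤ n) (hV : Fintype.card V = n) :
    -- the stationary distribution exists, is unique, and is positive
    (∀ D : Digraph V, D.IsSimple → D.IsStronglyConnected →
      (∃! p : V → ℝ, D.IsStationaryDistribution p) ∧
        ∀ p : V → ℝ, D.IsStationaryDistribution p → ∀ v, 0 < p v) ∧
    -- the maximum of the principal ratio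
    IsGreatest {r : ℝ | ∃ D : Digraph V, D.IsSimple ∧ D.IsStronglyConnected ∧
        D.principalRatio = r}
      (2 / 3 * ((n : ℝ) / ((n : ℝ) - 1) +
        1 / ((n - 1)! : ℝ) * ∑ i ∈ Finset.Icc 1 (n - 3), (i ! : ℝ)) * ((n - 1)! : ℝ)) ∧
    -- the digraphs that attain it
    (∀ D : Digraph V,
      (D.IsSimple ∧ D.IsStronglyConnected ∧
        D.principalRatio = 2 / 3 * ((n : ℝ) / ((n : ℝ) - 1) +
          1 / ((n - 1)! : ℝ) * ∑ i ∈ Finset.Icc 1 (n - 3), (i ! : ℝ)) * ((n - 1)! : ℝ)) ↔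
      (D.IsIsomorphic (Digraph.extremal₁ n) ∨ D.IsIsomorphic (Digraph.extremal₂ n) ∨
        D.IsIsomorphic (Digraph.extremal₃ n))) ∧
    -- the three digraphs are pairwise non-isomorphic
    ¬ (Digraph.extremal₁ n).IsIsomorphic (Digraph.extremal₂ n) ∧
    ¬ (Digraph.extremal₁ n).IsIsomorphic (Digraph.extremal₃ n) ∧
    ¬ (Digraph.extremal₂ n).IsIsomorphic (Digraph.extremal₃ n) := by
  have : Nontrivial V := Fintype.one_lt_card_iff_nontrivial.1 (by lia)
  obtain ⟨k, hk⟩ : ∃ k, n = k + 3 := ⟨n - 3, by lia⟩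
  rw [Digraph.ratioBound_eq_closedForm hk, ← hV]
  have hcard : Fintype.card V = k + 3 := hV.trans hk
  refine ⟨fun D _ hD => ?_, ⟨?_, ?_⟩, fun D => ?_, ?_, ?_, ?_⟩
  · have h := Digraph.exists_adj_of_isStronglyConnected hD
    obtain ⟨p, hp⟩ := Digraph.exists_isStationaryDistribution h
    exact ⟨⟨p, hp, fun q hq => hq.eq h hD hp⟩, fun q hq => hq.pos hD⟩
  · let D : Digraph V := ⟨fun a b => (Digraph.extremal₁ (Fintype.card V)).Adj
      (Fintype.equivFin V a) (Fintype.equivFin V b)⟩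
    have hiso : D.IsIsomorphic (Digraph.extremal₁ (Fintype.card V)) :=
      ⟨Fintype.equivFin V, Iff.rfl⟩
    exact ⟨D, (Digraph.principalRatio_eq_iff hcard).2
      ((Digraph.exists_isExtremalLabelling_iff rfl (by lia)).2 (Or.inl hiso))⟩
  · rintro r ⟨D, hs, hD, rfl⟩
    exact Digraph.principalRatio_le hcard hs hD
  · rw [Digraph.principalRatio_eq_iff hcard, Digraph.exists_isExtremalLabelling_iff rfl (by lia)]
  · exact Digraph.not_isIsomorphic_extremal₁_extremal₂ (by lia)
  · exact Digraph.not_isIsomorphic_extremal₃ (by lia) (by lia)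
  · exact Digraph.not_isIsomorphic_extremal₃ (by lia) (by lia)
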